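/- Let $\mathsf{Grp}(\mathsf{HComp})$ be the category of compact Hausdorff topological groups and continuous homomorphisms, let $\mathsf{Ab}(\mathsf{HComp})$ be its full subcategory of abelian groups, and let $\mathsf{Ab}(\mathsf{Prof})$ be the full subcategory of abelian profinite (i.e. abelian and totally disconnected) groups. Write $\overline{X}$ for topological closure and $G_0$ for the connected component of the neutral element of $G$. Let $I\colon \mathsf{Grp}(\mathsf{HComp})\to\mathsf{Ab}(\mathsf{Prof})$ be the composite of the reflectors $G\mapsto G/\overline{[G,G]}$ onto $\mathsf{Ab}(\mathsf{HComp})$ and $A\mapsto A/A_0$ onto $\mathsf{Ab}(\mathsf{Prof})$; it is left adjoint to the inclusion, with unit $\eta$. An extension of $B$ is a regular epimorphism $p\colon E\to B$ in $\mathsf{Grp}(\mathsf{HComp})$. It is trivial if its naturality square for $\eta$ is a pullback. It is normal if pulling back along $p$ is a monadic functor from extensions of $B$ to extensions of $E$, and the first projection $\pi_1\colon E\times_B E\to E$ is a trivial extension. It is a weakly universal normal extension if it is normal and, for every normal extension $p'\colon E'\to B$, there is a morphism $u\colon E\to E'$ with $p'u=p$. The Galois group $\mathsf{Gal}(E,p,0)$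 of a normal extension $p$ is the pullback in $\mathsf{Ab}(\mathsf{Prof})$ of $0\to I(E)\times I(E)$ along $\langle I(\pi_1),I(\pi_2)\rangle\colon I(E\times_B E)\to I(E)\times I(E)$, and the fundamental group $\pi_1(B)$ is the Galois group of any weakly universal normal extension of $B$. Let $f\colon P\to B$ be a regular epimorphism of compact Hausdorff groups with kernel $K$, where $P$ is projective with respect to regular epimorphisms. Then $B$ has a weakly universal normal extension, and for every weakly universal normal extension $p\colon E\to B$ there is an isomorphism of topological groups $$\pi_1(B)=\mathsf{Gal}(E,p,0)\;\cong\;\frac{K\cap\bigl(\overline{[P,P]}\cdot P_0\bigr)}{\overline{[K,P]}\cdot K_0}.$$ -/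

import Mathlib

open CategoryTheory CategoryTheory.Limits

universe u v₁ v₂ u₁ u₂

/-! ### Galois structures, normal extensions, Galois groups -/

/-- A Galois structure: a full reflective subcategory `H : ℬ ⥤ 𝒜` with reflector `I`, together with
a class `E` of morphisms of `𝒜` (the extensions) that contains the isomorphisms, is closed under
composition, is pullback stable, and is preserved by `H ∘ I`.  Pullbacks along members of `E`
exist since `𝒜` is assumed to have pullbacks. -/
structure GaloisStructure (𝒜 : Type u₁) [Category.{v₁} 𝒜] [HasPullbacks 𝒜]
    (ℬ : Type u₂) [Category.{v₂} ℬ] where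
  /-- the reflector -/
  I : 𝒜 ⥤ ℬ
  /-- the inclusion -/
  H : ℬ ⥤ 𝒜
  /-- the adjunction -/
  adj : I ⊣ H
  full : H.Full
  faithful : H.Faithful
  /-- the class of extensions -/
  E : MorphismProperty 𝒜
  map_mem : ∀ {X Y : 𝒜} (f : X ⟶ Y), E f → E (H.map (I.map f))
  isMultiplicative : E.IsMultiplicative
  isStableUnderBaseChange : E.IsStableUnderBaseChange

namespace GaloisStructure

variable {𝒜 : Type u₁} [Category.{v₁} 𝒜] [HasPullbacks 𝒜] {ℬ : Type u₂} [Category.{v₂} ℬ]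
  (Γ : GaloisStructure 𝒜 ℬ)

instance : Γ.E.IsMultiplicative := Γ.isMultiplicative

instance : Γ.E.IsStableUnderBaseChange := Γ.isStableUnderBaseChange

/-- The pullback functor `p^* : 𝒜 ↓ B ⥤ 𝒜 ↓ X`, where `𝒜 ↓ B` is the full subcategory of the slice
category over `B` whose objects are the extensions of `B`. -/
noncomputable def pullbackFunctor {X B : 𝒜} (p : X ⟶ B) : Γ.E.Over ⊤ B ⥤ Γ.E.Over ⊤ X :=
  MorphismProperty.Over.pullback Γ.E ⊤ p

/-- Monadic extensions: members of `E` whose pullback functor is monadic. -/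
def IsMonadicExtension {X B : 𝒜} (p : X ⟶ B) : Prop :=
  Γ.E p ∧ Nonempty (MonadicRightAdjoint (Γ.pullbackFunctor p))

/-- Trivial extensions: the naturality square of the unit at `f` is a pullback. -/
def IsTrivialExtension {X B : 𝒜} (f : X ⟶ B) : Prop :=
  Γ.E f ∧ IsPullback (Γ.adj.unit.app X) f (Γ.H.map (Γ.I.map f)) (Γ.adj.unit.app B)

/-- Normal extensions: monadic extensions `p` such that `p^*(p)`, the first projection of the
kernel pair of `p`, is a trivial extension. -/
def IsNormalExtension {X B : 𝒜} (p : X ⟶ B) : Prop :=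
  Γ.IsMonadicExtension p ∧ Γ.IsTrivialExtension (pullback.fst p p)

/-- Weakly universal normal extensions of `B`. -/
def IsWeaklyUniversalNormalExtension {X B : 𝒜} (p : X ⟶ B) : Prop :=
  Γ.IsNormalExtension p ∧
    ∀ ⦃X' : 𝒜⦄ (p' : X' ⟶ B), Γ.IsNormalExtension p' → ∃ u : X ⟶ X', u ≫ p' = p

/-- The Galois group `Gal(X, p, 0)`: the pullback of `0 ⟶ I(X) × I(X)` along
`⟨I(π₁), I(π₂)⟩ : I(X ×_B X) ⟶ I(X) × I(X)`. -/
noncomputable def galoisGroup [HasFiniteLimits ℬ] [HasZeroMorphisms ℬ] [HasZeroObject ℬ]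
    {X B : 𝒜} (p : X ⟶ B) : ℬ :=
  open scoped ZeroObject in
  pullback (prod.lift (Γ.I.map (pullback.fst p p)) (Γ.I.map (pullback.snd p p)))
    (0 : (0 : ℬ) ⟶ Γ.I.obj X ⨯ Γ.I.obj X)

end GaloisStructure

/-- `P` is projective with respect to the class `E` of morphisms. -/
def IsProjectiveWrt {𝒜 : Type u₁} [Category.{v₁} 𝒜] (E : MorphismProperty 𝒜) (P : 𝒜) : Prop :=
  ∀ ⦃X Y : 𝒜⦄ (e : X ⟶ Y) (g : P ⟶ Y), E e → ∃ l : P ⟶ X, l ≫ e = g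

/-! ### The category of compact Hausdorff groups -/

/-- Compact Hausdorff topological groups. -/
structure CompGrp : Type (u + 1) where
  /-- the underlying type -/
  carrier : Type u
  [group : Group carrier]
  [top : TopologicalSpace carrier]
  [isTopologicalGroup : IsTopologicalGroup carrier]
  [compact : CompactSpace carrier]
  [hausdorff : T2Space carrier]

namespace CompGrp

instance : CoeSort CompGrp.{u} (Type u) := ⟨CompGrp.carrier⟩

attribute [instance] group top isTopologicalGroup compact hausdorff

/-- Bundle a compact Hausdorff group. -/
abbrev of (G : Type u) [Group G] [TopologicalSpace G] [IsTopologicalGroup G] [CompactSpace G]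
    [T2Space G] : CompGrp.{u} := ⟨G⟩

/-- Morphisms are the continuous homomorphisms. -/
@[ext]
structure Hom (G H : CompGrp.{u}) : Type u where
  /-- the underlying continuous homomorphism -/
  hom' : G →ₜ* H

instance : Category.{u} CompGrp.{u} where
  Hom G H := Hom G H
  id G := ⟨ContinuousMonoidHom.id G⟩
  comp f g := ⟨g.hom'.comp f.hom'⟩

instance : ConcreteCategory CompGrp.{u} (fun G H => G →ₜ* H) where
  hom f := f.hom'
  ofHom f := ⟨f⟩

/-- The continuous homomorphism underlying a morphism. -/
abbrev Hom.hom {G H : CompGrp.{u}} (f : Hom G H) : G →ₜ* H :=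
  ConcreteCategory.hom (C := CompGrp) f

/-- A continuous homomorphism as a morphism. -/
abbrev ofHom {G H : CompGrp.{u}} (f : G →ₜ* H) : G ⟶ H := ConcreteCategory.ofHom (C := CompGrp) f

@[ext]
lemma hom_ext {G H : CompGrp.{u}} {f g : G ⟶ H} (h : ∀ x, f.hom x = g.hom x) : f = g :=
  Hom.ext (ContinuousMonoidHom.ext h)

@[simp]
lemma id_apply {G : CompGrp.{u}} (x : G) : Hom.hom (𝟙 G) x = x := rfl

@[simp]
lemma comp_apply {G H K : CompGrp.{u}} (f : G ⟶ H) (g : H ⟶ K) (x : G) :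
    (f ≫ g).hom x = g.hom (f.hom x) := rfl

@[simp]
lemma ofHom_apply {G H : CompGrp.{u}} (f : G →ₜ* H) (x : G) : (ofHom f).hom x = f x := rfl

/-- A closed subgroup, as an object. -/
def ofClosed {G : CompGrp.{u}} (S : Subgroup G) (hS : IsClosed (S : Set G)) : CompGrp.{u} :=
  have : CompactSpace S := isCompact_iff_compactSpace.mp hS.isCompact
  of S

/-- The quotient by a closed normal subgroup, as an object. -/
def quot {G : CompGrp.{u}} (N : Subgroup G) [N.Normal] (hN : IsClosed (N : Set G)) :
    CompGrp.{u} :=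
  have := hN
  of (G ⧸ N)

/-- The projection onto the quotient by a closed normal subgroup. -/
def quotMk {G : CompGrp.{u}} (N : Subgroup G) [N.Normal] (hN : IsClosed (N : Set G)) :
    G ⟶ quot N hN :=
  ofHom (H := quot N hN) ⟨QuotientGroup.mk' N, QuotientGroup.continuous_mk⟩

/-- The universal property of the quotient. -/
def quotLift {G H : CompGrp.{u}} (N : Subgroup G) [N.Normal] (hN : IsClosed (N : Set G))
    (f : G ⟶ H) (hf : ∀ x ∈ N, f.hom x = 1) : quot N hN ⟶ H :=
  ofHom (G := quot N hN) ⟨QuotientGroup.lift N f.hom.toMonoidHom hf,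
    Continuous.quotient_lift f.hom.continuous_toFun _⟩

lemma quotMk_surjective {G : CompGrp.{u}} (N : Subgroup G) [N.Normal]
    (hN : IsClosed (N : Set G)) : Function.Surjective (quotMk N hN).hom :=
  QuotientGroup.mk'_surjective N

@[simp]
lemma quotLift_mk {G H : CompGrp.{u}} (N : Subgroup G) [N.Normal] (hN : IsClosed (N : Set G))
    (f : G ⟶ H) (hf : ∀ x ∈ N, f.hom x = 1) (x : G) :
    (quotLift N hN f hf).hom ((quotMk N hN).hom x) = f.hom x := rfl

lemma quotMk_eq_one {G : CompGrp.{u}} (N : Subgroup G) [N.Normal]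
    (hN : IsClosed (N : Set G)) {x : G} (hx : x ∈ N) : (quotMk N hN).hom x = 1 :=
  (QuotientGroup.eq_one_iff x).mpr hx

instance : HasZeroMorphisms CompGrp.{u} where
  zero G H := ⟨ofHom 1⟩
  comp_zero _ _ := rfl
  zero_comp _ _ _ f := by
    ext x
    exact map_one f.hom

lemma isZero_punit : IsZero (of PUnit.{u + 1}) where
  unique_to G := ⟨⟨⟨ofHom 1⟩, fun f => by
    ext x
    exact map_one f.hom⟩⟩
  unique_from G := ⟨⟨⟨ofHom 1⟩, fun f => rfl⟩⟩

instance : HasZeroObject CompGrp.{u} := ⟨⟨_, isZero_punit⟩⟩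

section Pullback

variable {X Y Z : CompGrp.{u}} (f : X ⟶ Z) (g : Y ⟶ Z)

/-- The explicit fibre product. -/
def fibre : CompGrp.{u} :=
  ofClosed (G := of (X × Y))
    (MonoidHom.eqLocus (f.hom.toMonoidHom.comp (MonoidHom.fst X Y))
      (g.hom.toMonoidHom.comp (MonoidHom.snd X Y)))
    (isClosed_eq (f.hom.continuous_toFun.comp continuous_fst)
      (g.hom.continuous_toFun.comp continuous_snd))

/-- First projection. -/
def fibreFst : fibre f g ⟶ X :=
  ofHom (G := fibre f g) ⟨(MonoidHom.fst X Y).comp (Subgroup.subtype _),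
    continuous_fst.comp continuous_subtype_val⟩

/-- Second projection. -/
def fibreSnd : fibre f g ⟶ Y :=
  ofHom (G := fibre f g) ⟨(MonoidHom.snd X Y).comp (Subgroup.subtype _),
    continuous_snd.comp continuous_subtype_val⟩

lemma isPullback_fibre : IsPullback (fibreFst f g) (fibreSnd f g) f g where
  w := by
    ext x
    exact x.2
  isLimit' := ⟨PullbackCone.IsLimit.mk _
    (fun s => ofHom (H := fibre f g)
      ⟨(s.fst.hom.toMonoidHom.prod s.snd.hom.toMonoidHom).codRestrict _
        (fun x => congrArg (fun k : s.pt ⟶ Z => k.hom x) s.condition),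
        (s.fst.hom.continuous_toFun.prodMk s.snd.hom.continuous_toFun).subtype_mk _⟩)
    (fun s => rfl) (fun s => rfl)
    (fun s m h₁ h₂ => by
      ext x
      exact Subtype.ext (Prod.ext (congrArg (fun k : s.pt ⟶ X => k.hom x) h₁)
        (congrArg (fun k : s.pt ⟶ Y => k.hom x) h₂)))⟩

end Pullback

instance : HasPullbacks CompGrp.{u} :=
  have : ∀ {X Y Z : CompGrp.{u}} {f : X ⟶ Z} {g : Y ⟶ Z}, HasLimit (cospan f g) :=
    fun {_ _ _ f g} => (isPullback_fibre f g).hasPullback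
  hasPullbacks_of_hasLimit_cospan _

instance : HasFiniteLimits CompGrp.{u} := hasFiniteLimits_of_hasTerminal_and_pullbacks

lemma surjective_of_isIso {X Y : CompGrp.{u}} (f : X ⟶ Y) [IsIso f] :
    Function.Surjective f.hom := fun y =>
  ⟨(inv f).hom y, congrArg (fun k : Y ⟶ Y => k.hom y) (IsIso.inv_hom_id f)⟩

/-- Regular epimorphisms of compact groups are exactly the surjective morphisms. -/
lemma isRegularEpi_iff_surjective {X Y : CompGrp.{u}} (f : X ⟶ Y) :
    IsRegularEpi f ↔ Function.Surjective f.hom := by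
  constructor
  · intro hf
    have hcl : IsClosed ((f.hom.toMonoidHom.range : Subgroup Y) : Set Y) :=
      (isCompact_range f.hom.continuous_toFun).isClosed
    let e : X ⟶ ofClosed _ hcl := ofHom (H := ofClosed _ hcl)
      ⟨f.hom.toMonoidHom.rangeRestrict, f.hom.continuous_toFun.subtype_mk _⟩
    let m : ofClosed _ hcl ⟶ Y := ofHom (G := ofClosed _ hcl)
      ⟨Subgroup.subtype _, continuous_subtype_val⟩
    have hm : Mono m := ⟨fun a b h => by
      ext x
      exact Subtype.ext (congrArg (fun k => Hom.hom k x) h)⟩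
    have hem : e ≫ m = f := rfl
    have : IsIso m := ExtremalEpi.isIso f e m hem
    intro y
    obtain ⟨⟨_, x, rfl⟩, hy⟩ := surjective_of_isIso m y
    exact ⟨x, hy⟩
  · intro hf
    have hq : Topology.IsQuotientMap f.hom :=
      f.hom.continuous_toFun.isClosedMap.isQuotientMap f.hom.continuous_toFun hf
    refine ⟨⟨⟨fibre f f, fibreFst f f, fibreSnd f f, (isPullback_fibre f f).w, ?_⟩⟩⟩
    have key : ∀ {Z : CompGrp.{u}} (k : X ⟶ Z) (_ : fibreFst f f ≫ k = fibreSnd f f ≫ k)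
        (a b : X), f.hom a = f.hom b → k.hom a = k.hom b := fun k hk a b hab =>
      congrArg (fun l : fibre f f ⟶ _ => l.hom ⟨(a, b), hab⟩) hk
    refine Cofork.IsColimit.mk' _ fun s => ?_
    have hs := fun a b => key s.π s.condition a b
    have hinv : ∀ y, f.hom (Function.surjInv hf y) = y := Function.surjInv_eq hf
    refine ⟨ofHom ⟨MonoidHom.mk' (fun y => s.π.hom (Function.surjInv hf y)) ?_, ?_⟩, ?_, ?_⟩
    · intro a b
      rw [← map_mul]
      exact hs _ _ (by rw [map_mul, hinv, hinv, hinv])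
    · refine hq.continuous_iff.mpr (s.π.hom.continuous_toFun.congr fun x => ?_)
      exact hs _ _ (hinv _).symm
    · ext x
      exact hs _ _ (hinv _)
    · intro m hm
      ext y
      obtain ⟨x, rfl⟩ := hf y
      exact (congrArg (fun l : X ⟶ s.pt => l.hom x) hm).trans (hs _ _ (hinv _).symm)

instance : (MorphismProperty.regularEpi CompGrp.{u}).IsMultiplicative where
  id_mem _ := (isRegularEpi_iff_surjective _).mpr Function.surjective_id
  comp_mem f g hf hg := (isRegularEpi_iff_surjective _).mpr
    (((isRegularEpi_iff_surjective g).mp hg).comp ((isRegularEpi_iff_surjective f).mp hf))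

instance : (MorphismProperty.regularEpi CompGrp.{u}).IsStableUnderBaseChange where
  of_isPullback {X Y Y' S f g f' g'} sq hg := by
    rw [MorphismProperty.regularEpi_iff, isRegularEpi_iff_surjective] at hg ⊢
    intro y
    obtain ⟨x, hx⟩ := hg (f.hom y)
    let t := sq.lift (fibreFst g f) (fibreSnd g f) (isPullback_fibre g f).w
    exact ⟨t.hom ⟨(x, y), hx⟩, congrArg (fun l : fibre g f ⟶ _ => l.hom ⟨(x, y), hx⟩)
      (sq.lift_snd _ _ _)⟩

/-! ### Abelian compact groups and abelian profinite groups -/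

/-- Commutativity, as a property of compact groups. -/
def isAbelian : ObjectProperty CompGrp.{u} := fun G => ∀ x y : G, x * y = y * x

/-- `Ab(HComp)`: the full subcategory of abelian compact groups. -/
abbrev AbComp : Type (u + 1) := (isAbelian.{u}).FullSubcategory

/-- Total disconnectedness, as a property of abelian compact groups. -/
def isProfinite : ObjectProperty AbComp.{u} := fun G => TotallyDisconnectedSpace G.obj

/-- `Ab(Prof)`: the full subcategory of abelian profinite groups. -/
abbrev AbProf : Type (u + 1) := (isProfinite.{u}).FullSubcategory

/-- The closure of the derived subgroup. -/
def closedDerived (G : CompGrp.{u}) : Subgroup G := (commutator G).topologicalClosure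

lemma isClosed_closedDerived (G : CompGrp.{u}) : IsClosed (closedDerived G : Set G) :=
  Subgroup.isClosed_topologicalClosure _

instance (G : CompGrp.{u}) : (closedDerived G).Normal :=
  Subgroup.is_normal_topologicalClosure _

open scoped commutatorElement in
/-- The abelianization `G / cl[G, G]`. -/
def abObj (G : CompGrp.{u}) : AbComp.{u} where
  obj := quot (closedDerived G) (isClosed_closedDerived G)
  property := by
    intro x y
    obtain ⟨a, rfl⟩ := quotMk_surjective _ _ x
    obtain ⟨b, rfl⟩ := quotMk_surjective _ _ y
    rw [← map_mul, ← map_mul]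
    refine QuotientGroup.eq.mpr (Subgroup.le_topologicalClosure _ ?_)
    have h : (a * b)⁻¹ * (b * a) = ⁅b⁻¹, a⁻¹⁆ := by
      simp only [commutatorElement_def]
      group
    rw [h]
    exact Subgroup.commutator_mem_commutator (Subgroup.mem_top _) (Subgroup.mem_top _)

open scoped commutatorElement in
lemma hom_closedDerived {G A : CompGrp.{u}} (hA : isAbelian A) (f : G ⟶ A) :
    ∀ x ∈ closedDerived G, f.hom x = 1 := by
  have h1 : commutator G ≤ f.hom.toMonoidHom.ker := by
    refine Subgroup.commutator_le.mpr fun a _ b _ => ?_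
    rw [MonoidHom.mem_ker, map_commutatorElement, commutatorElement_eq_one_iff_mul_comm]
    exact hA _ _
  have h2 : closedDerived G ≤ f.hom.toMonoidHom.ker :=
    Subgroup.topologicalClosure_minimal _ h1
      (isClosed_singleton.preimage f.hom.continuous_toFun)
  exact fun x hx => h2 hx

/-- The universal property of the abelianization. -/
def abEquiv (G : CompGrp.{u}) (A : AbComp.{u}) :
    (abObj G ⟶ A) ≃ (G ⟶ isAbelian.ι.obj A) where
  toFun f := quotMk _ (isClosed_closedDerived G) ≫ f.hom
  invFun f := ObjectProperty.homMk (quotLift _ (isClosed_closedDerived G) f (hom_closedDerived A.property f))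
  left_inv f := by
    apply ObjectProperty.hom_ext
    ext x
    obtain ⟨a, rfl⟩ := quotMk_surjective (closedDerived G) (isClosed_closedDerived G) x
    rfl
  right_inv f := rfl

/-- The reflector `ab : Grp(HComp) ⥤ Ab(HComp)`. -/
def ab : CompGrp.{u} ⥤ AbComp.{u} :=
  Adjunction.leftAdjointOfEquiv abEquiv (fun _ _ _ _ _ => rfl)

/-- The adjunction between `ab` and the inclusion. -/
def abAdj : ab.{u} ⊣ isAbelian.{u}.ι :=
  Adjunction.adjunctionOfEquivLeft abEquiv (fun _ _ _ _ _ => rfl)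

/-- The identity component, as a normal subgroup. -/
def idComp (G : CompGrp.{u}) : Subgroup G := Subgroup.connectedComponentOfOne G

lemma isClosed_idComp (G : CompGrp.{u}) : IsClosed (idComp G : Set G) :=
  isClosed_connectedComponent

instance (G : CompGrp.{u}) : (idComp G).Normal where
  conj_mem x hx g := by
    have hc : Continuous fun y : G => g * y * g⁻¹ := by fun_prop
    have := hc.image_connectedComponent_subset (1 : G) ⟨x, hx, rfl⟩
    simpa [idComp, Subgroup.connectedComponentOfOne] using this

lemma hom_idComp {G A : CompGrp.{u}} [TotallyDisconnectedSpace A] (f : G ⟶ A) :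
    ∀ x ∈ idComp G, f.hom x = 1 := by
  intro x hx
  have := f.hom.continuous_toFun.image_connectedComponent_subset (1 : G) ⟨x, hx, rfl⟩
  rw [totallyDisconnectedSpace_iff_connectedComponent_singleton.mp inferInstance] at this
  exact this.trans (map_one f.hom)

lemma totallyDisconnected_quot_idComp (G : CompGrp.{u}) :
    TotallyDisconnectedSpace (quot (idComp G) (isClosed_idComp G)) := by
  have key : ∀ a : G, (QuotientGroup.mk : G → G ⧸ idComp G) ⁻¹' {QuotientGroup.mk a} =
      connectedComponent a := by
    intro a
    have h := smul_connectedComponent a (1 : G)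
    rw [mul_one] at h
    rw [← h]
    ext b
    rw [Set.mem_smul_set_iff_inv_smul_mem, Set.mem_preimage, Set.mem_singleton_iff, eq_comm,
      QuotientGroup.eq]
    rfl
  refine totallyDisconnectedSpace_iff_connectedComponent_singleton.mpr ?_
  change ∀ x : G ⧸ idComp G, connectedComponent x = {x}
  have hc : Topology.IsQuotientMap (QuotientGroup.mk : G → G ⧸ idComp G) :=
    QuotientGroup.isQuotientMap_mk (N := idComp G)
  have hfib : ∀ y : G ⧸ idComp G, IsConnected ((QuotientGroup.mk : G → G ⧸ idComp G) ⁻¹' {y}) := by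
    intro y
    obtain ⟨a, rfl⟩ := QuotientGroup.mk_surjective y
    rw [key]
    exact isConnected_connectedComponent
  intro x
  obtain ⟨a, rfl⟩ := QuotientGroup.mk_surjective x
  rw [← hc.isCoinducing.image_connectedComponent hfib, ← key,
    Set.image_preimage_eq _ QuotientGroup.mk_surjective]

/-- The reflection `A / A₀` of an abelian compact group `A`. -/
def profObj (A : AbComp.{u}) : AbProf.{u} where
  obj :=
    { obj := quot (idComp A.obj) (isClosed_idComp A.obj)
      property := by
        intro x y
        obtain ⟨a, rfl⟩ := quotMk_surjective _ _ x
        obtain ⟨b, rfl⟩ := quotMk_surjective _ _ y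
        rw [← map_mul, ← map_mul, A.property a b] }
  property := totallyDisconnected_quot_idComp A.obj

/-- The universal property of `A / A₀`. -/
def profEquiv (A : AbComp.{u}) (C : AbProf.{u}) :
    (profObj A ⟶ C) ≃ (A ⟶ isProfinite.ι.obj C) where
  toFun f := ObjectProperty.homMk (quotMk _ (isClosed_idComp A.obj) ≫ f.hom.hom)
  invFun f := ObjectProperty.homMk (ObjectProperty.homMk
    (quotLift (H := C.obj.obj) _ (isClosed_idComp A.obj) f.hom
      (have : TotallyDisconnectedSpace C.obj.obj := C.property
       hom_idComp (A := C.obj.obj) f.hom)))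
  left_inv f := by
    apply ObjectProperty.hom_ext
    apply ObjectProperty.hom_ext
    ext x
    obtain ⟨a, rfl⟩ := quotMk_surjective (idComp A.obj) (isClosed_idComp A.obj) x
    rfl
  right_inv f := rfl

/-- The reflector `F : Ab(HComp) ⥤ Ab(Prof)`. -/
def prof : AbComp.{u} ⥤ AbProf.{u} :=
  Adjunction.leftAdjointOfEquiv profEquiv (fun _ _ _ _ _ => rfl)

/-- The adjunction between `F` and the inclusion. -/
def profAdj : prof.{u} ⊣ isProfinite.{u}.ι :=
  Adjunction.adjunctionOfEquivLeft profEquiv (fun _ _ _ _ _ => rfl)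

/-- The composite reflector `Grp(HComp) ⥤ Ab(Prof)`. -/
def reflector : CompGrp.{u} ⥤ AbProf.{u} := ab ⋙ prof

/-- The inclusion `Ab(Prof) ⥤ Grp(HComp)`. -/
def incl : AbProf.{u} ⥤ CompGrp.{u} := isProfinite.ι ⋙ isAbelian.ι

instance : incl.{u}.Full := inferInstanceAs (isProfinite.{u}.ι ⋙ isAbelian.{u}.ι).Full

instance : incl.{u}.Faithful := inferInstanceAs (isProfinite.{u}.ι ⋙ isAbelian.{u}.ι).Faithful

/-- The composite adjunction. -/
def reflectorAdj : reflector.{u} ⊣ incl.{u} := abAdj.comp profAdj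

lemma unit_surjective (G : CompGrp.{u}) :
    Function.Surjective (Hom.hom (reflectorAdj.unit.app G)) := by
  have h : Hom.hom (reflectorAdj.unit.app G) =
      Hom.hom (quotMk _ (isClosed_closedDerived G) ≫
        quotMk _ (isClosed_idComp (abObj G).obj)) := rfl
  rw [h]
  exact (quotMk_surjective _ (isClosed_idComp _)).comp (quotMk_surjective _ _)

/-- The Galois structure of the reflection `Grp(HComp) ⥤ Ab(Prof)`, with the regular epimorphisms
as extensions. -/
def galoisStructure : GaloisStructure CompGrp.{u} AbProf.{u} where
  I := reflector
  H := incl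
  adj := reflectorAdj
  full := inferInstance
  faithful := inferInstance
  E := MorphismProperty.regularEpi CompGrp.{u}
  map_mem {X Y} f hf := by
    rw [MorphismProperty.regularEpi_iff, isRegularEpi_iff_surjective] at hf ⊢
    have h : f ≫ reflectorAdj.unit.app Y =
        reflectorAdj.unit.app X ≫ incl.map (reflector.map f) := reflectorAdj.unit.naturality f
    have hs : Function.Surjective (f ≫ reflectorAdj.unit.app Y).hom :=
      (unit_surjective Y).comp hf
    rw [h] at hs
    exact Function.Surjective.of_comp (g := Hom.hom (reflectorAdj.unit.app X)) hs
  isMultiplicative := inferInstance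
  isStableUnderBaseChange := inferInstance

instance : HasFiniteLimits AbProf.{u} where
  out _ _ _ :=
    have : Reflective incl.{u} := ⟨reflector, reflectorAdj⟩
    hasLimitsOfShape_of_reflective incl.{u}

instance : HasZeroObject AbProf.{u} :=
  ⟨⟨⟨of PUnit.{u + 1}, fun _ _ => rfl⟩, inferInstanceAs (TotallyDisconnectedSpace PUnit)⟩,
    ⟨fun Y => ⟨⟨⟨ObjectProperty.homMk (ObjectProperty.homMk 0)⟩, fun f => by
        apply ObjectProperty.hom_ext
        apply ObjectProperty.hom_ext
        exact isZero_punit.eq_of_src _ _⟩⟩,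
      fun Y => ⟨⟨⟨ObjectProperty.homMk (ObjectProperty.homMk 0)⟩, fun f => by
        apply ObjectProperty.hom_ext
        apply ObjectProperty.hom_ext
        exact isZero_punit.eq_of_tgt _ _⟩⟩⟩⟩

/-! ### The right-hand side of the Hopf formula -/

variable {P : CompGrp.{u}} (K : Subgroup P)

/-- `K ∧ (cl[P, P] · P₀)`; the product of two normal subgroups is their supremum. -/
def hopfNum : Subgroup P := K ⊓ (closedDerived P ⊔ idComp P)

/-- The identity component `K₀` of the group `K` (with its subspace topology), as a subgroup
of `P`. -/
def idCompOf : Subgroup P := (Subgroup.connectedComponentOfOne K).map K.subtype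

/-- `cl[K, P] · K₀`; the product of two normal subgroups is their supremum. -/
def hopfDen : Subgroup P := (⁅K, (⊤ : Subgroup P)⁆).topologicalClosure ⊔ idCompOf K

instance [hK : K.Normal] : (idCompOf K).Normal where
  conj_mem := by
    rintro _ ⟨x, hx, rfl⟩ g
    have hc : Continuous fun y : K => (⟨g * y * g⁻¹, hK.conj_mem y y.2 g⟩ : K) := by fun_prop
    refine ⟨⟨g * x * g⁻¹, hK.conj_mem x x.2 g⟩, ?_, rfl⟩
    have := hc.image_connectedComponent_subset (1 : K) ⟨x, hx, rfl⟩
    have h1 : (⟨g * (1 : K) * g⁻¹, hK.conj_mem _ (1 : K).2 g⟩ : K) = 1 := by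
      apply Subtype.ext
      simp
    rw [h1] at this
    exact this

instance [K.Normal] : (hopfDen K).Normal :=
  have : ((⁅K, (⊤ : Subgroup P)⁆).topologicalClosure).Normal :=
    Subgroup.is_normal_topologicalClosure _
  Subgroup.sup_normal _ _

/-- The topological group `(K ∧ (cl[P, P] · P₀)) / (cl[K, P] · K₀)`. -/
abbrev HopfQuotient [K.Normal] : Type u := hopfNum K ⧸ (hopfDen K).subgroupOf (hopfNum K)

end CompGrp

/-!
The unit `G ⟶ I(G)` is the quotient by the *radical* of `G`, namely `cl[G, G] · G₀`.  Since
surjections map radicals onto radicals, a surjection is a trivial extension exactly when its kernel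
meets the radical trivially.  Applied to kernel pairs, this identifies the normal extensions with
the surjections that have a central totally disconnected kernel (every surjection is monadic, by
the reflexive monadicity theorem), and the Galois group of a normal extension `p` with the
intersection of the kernel of `p` and the radical.

Two morphisms that agree modulo a central totally disconnected subgroup coincide on radicals, so
this intersection depends on `B` only, as long as `p` is weakly universal.  If `f : P ⟶ B` has
kernel `K` and lifts through every normal extension of `B`, for example because `P` is projective,
then such a lift kills `cl[K, P] · K₀`.  Hence the quotient of `P` by this subgroup is a weakly
universal normal extension of `B`, and the formula is read off from it.
-/

section Group

variable {G H : Type*} [Group G] [Group H]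

lemma inv_mul_mem_map_ker_of_section {f g : G →* H} {s : H → G} (hf : Function.LeftInverse f s)
    (hg : Function.LeftInverse g s) (x : G) : (f x)⁻¹ * g x ∈ g.ker.map f :=
  ⟨x⁻¹ * s (g x), by simp [MonoidHom.mem_ker, hg (g x)], by simp [hf (g x)]⟩

/-- The pointwise quotient `x ↦ (a x)⁻¹ * b x` of two homomorphisms that agree modulo the center. -/
def invMulOfMemCenter (a b : G →* H) (h : ∀ x, (a x)⁻¹ * b x ∈ Subgroup.center H) : G →* H :=
  MonoidHom.mk' (fun x => (a x)⁻¹ * b x) fun x y => by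
    calc (a (x * y))⁻¹ * b (x * y) = (a y)⁻¹ * ((a x)⁻¹ * b x) * b y := by
          simp only [map_mul, mul_inv_rev, mul_assoc]
      _ = (a x)⁻¹ * b x * ((a y)⁻¹ * b y) := by
          rw [Subgroup.mem_center_iff.mp (h x), mul_assoc]

end Group

section TopologicalGroup

variable {G H : Type*} [Group G] [TopologicalSpace G] [IsTopologicalGroup G] [CompactSpace G]
  [Group H] [TopologicalSpace H] [IsTopologicalGroup H] [T2Space H]

lemma isClosed_sup_of_normal [T2Space G] {M N : Subgroup G} [N.Normal]
    (hM : IsClosed (M : Set G)) (hN : IsClosed (N : Set G)) :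
    IsClosed ((M ⊔ N : Subgroup G) : Set G) := by
  rw [Subgroup.mul_normal]
  exact (hM.isCompact.mul hN.isCompact).isClosed

lemma totallyDisconnectedSpace_of_surjective [TotallyDisconnectedSpace G] {q : G →ₜ* H}
    (hq : Function.Surjective q) : TotallyDisconnectedSpace H := by
  have hopen : IsOpenMap q := (MonoidHom.isOpenQuotientMap_of_isQuotientMap
    (q.continuous_toFun.isClosedMap.isQuotientMap q.continuous_toFun hq)).isOpenMap
  refine totallyDisconnectedSpace_iff_connectedComponent_one.mpr
    (subset_antisymm (fun y hy => ?_) (Set.singleton_subset_iff.mpr mem_connectedComponent))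
  -- An open normal subgroup of `G` avoiding the fibre of `y ≠ 1` has a clopen image avoiding `y`.
  by_contra hne
  obtain ⟨N, hN⟩ := ProfiniteGrp.exist_openNormalSubgroup_sub_open_nhds_of_one
    (U := q ⁻¹' {y}ᶜ) (isOpen_compl_singleton.preimage q.continuous_toFun)
    fun h : q 1 = y => hne (h.symm.trans (map_one q))
  let M : Subgroup H := (N : Subgroup G).map q.toMonoidHom
  have hM : IsOpen (M : Set H) := hopen _ N.isOpen'
  obtain ⟨x, hx, hxy⟩ := IsClopen.connectedComponent_subset ⟨M.isClosed_of_isOpen hM, hM⟩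
    M.one_mem hy
  exact hN hx hxy

end TopologicalGroup

namespace CompGrp

section Basic

variable {X Y Z : CompGrp.{u}}

/-- The kernel of a morphism, as a subgroup of its domain. -/
abbrev ker (f : X ⟶ Y) : Subgroup X := f.hom.toMonoidHom.ker

lemma isClosed_ker (f : X ⟶ Y) : IsClosed (ker f : Set X) :=
  isClosed_singleton.preimage f.hom.continuous_toFun

lemma ker_comp (f : X ⟶ Y) (g : Y ⟶ Z) : ker (f ≫ g) = (ker g).comap f.hom.toMonoidHom := rfl

lemma map_ker_comp {f : X ⟶ Y} (hf : Function.Surjective f.hom) (g : Y ⟶ Z) :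
    (ker (f ≫ g)).map f.hom.toMonoidHom = ker g :=
  Subgroup.map_comap_eq_self_of_surjective hf (ker g)

lemma isClosed_map (f : X ⟶ Y) {S : Subgroup X} (hS : IsClosed (S : Set X)) :
    IsClosed (S.map f.hom.toMonoidHom : Set Y) :=
  (hS.isCompact.image f.hom.continuous_toFun).isClosed

@[simp]
lemma ker_quotMk (N : Subgroup X) [N.Normal] (hN : IsClosed (N : Set X)) :
    ker (quotMk N hN) = N := QuotientGroup.ker_mk' N

lemma exists_desc {q : X ⟶ Y} (hq : Function.Surjective q.hom) {k : X ⟶ Z} (h : ker q ≤ ker k) :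
    ∃ l : Y ⟶ Z, q ≫ l = k := by
  have := (isRegularEpi_iff_surjective q).mpr hq
  let r := IsRegularEpi.getStruct q
  obtain ⟨l, hl⟩ := r.desc' k <| hom_ext fun w =>
    (MonoidHom.eq_iff k.hom.toMonoidHom).mpr <| h <|
      (MonoidHom.eq_iff q.hom.toMonoidHom).mp <| ConcreteCategory.congr_hom r.w w
  exact ⟨l, hl⟩

lemma surjective_of_comp {q : X ⟶ Y} {l : Y ⟶ Z} (h : Function.Surjective (q ≫ l).hom) :
    Function.Surjective l.hom := Function.Surjective.of_comp (g := q.hom) h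

instance : (forget CompGrp.{u}).ReflectsIsomorphisms where
  reflects f hf := by
    have hbij : Function.Bijective f.hom := (isIso_iff_bijective _).mp hf
    have := ConcreteCategory.mono_of_injective f hbij.1
    have := (isRegularEpi_iff_surjective f).mpr hbij.2
    exact isIso_of_mono_of_strongEpi f

lemma isIso_iff_ker_eq_bot_and_surjective {f : X ⟶ Y} :
    IsIso f ↔ ker f = ⊥ ∧ Function.Surjective f.hom := by
  rw [ConcreteCategory.isIso_iff_bijective, MonoidHom.ker_eq_bot_iff]
  rfl

/-- The first isomorphism theorem.  The kernel enters as a subgroup `N` equal to it, since quotients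
by equal subgroups are not definitionally equal. -/
noncomputable def quotIsoOfSurjective {N : Subgroup X} [N.Normal] (hN : IsClosed (N : Set X))
    (q : X ⟶ Y) (hq : Function.Surjective q.hom) (h : ker q = N) : quot N hN ≅ Y :=
  have : IsIso (quotLift N hN q h.ge) := by
    refine isIso_iff_ker_eq_bot_and_surjective.mpr
      ⟨(Subgroup.eq_bot_iff_forall _).mpr fun x hx => ?_,
        fun _ => (hq _).imp' (quotMk N hN).hom fun _ hx => hx⟩
    obtain ⟨x, rfl⟩ := quotMk_surjective N hN x
    exact quotMk_eq_one N hN (h.le hx)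
  asIso (quotLift N hN q h.ge)

/-- Isomorphic compact groups are isomorphic as topological groups. -/
def continuousMulEquivOfIso (e : X ≅ Y) : X ≃ₜ* Y where
  toFun := e.hom.hom
  invFun := e.inv.hom
  left_inv := ConcreteCategory.congr_hom e.hom_inv_id
  right_inv := ConcreteCategory.congr_hom e.inv_hom_id
  map_mul' := map_mul e.hom.hom
  continuous_toFun := e.hom.hom.continuous_toFun
  continuous_invFun := e.inv.hom.continuous_toFun

/-- The morphism between closed subgroups obtained by restricting a morphism. -/
def ofClosedMap (f : X ⟶ Y) {S : Subgroup X} {T : Subgroup Y} (hS : IsClosed (S : Set X))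
    (hT : IsClosed (T : Set Y)) (h : S ≤ T.comap f.hom.toMonoidHom) :
    ofClosed S hS ⟶ ofClosed T hT :=
  ofHom (G := ofClosed S hS) (H := ofClosed T hT)
    ⟨(f.hom.toMonoidHom.comp S.subtype).codRestrict T fun x => h x.2,
      (f.hom.continuous_toFun.comp continuous_subtype_val).subtype_mk _⟩

/-- The inclusion of a closed subgroup. -/
def ofClosedIncl {S : Subgroup X} (hS : IsClosed (S : Set X)) : ofClosed S hS ⟶ X :=
  ofHom (G := ofClosed S hS) ⟨S.subtype, continuous_subtype_val⟩

end Basic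

section Pullback

variable {W X Y Z : CompGrp.{u}} {a : W ⟶ X} {b : W ⟶ Y} {f : X ⟶ Z} {g : Y ⟶ Z}

lemma isPullback_iff : IsPullback a b f g ↔ a ≫ f = b ≫ g ∧ Disjoint (ker a) (ker b) ∧
    ∀ x y, f.hom x = g.hom y → ∃ w, a.hom w = x ∧ b.hom w = y := by
  have hfib := isPullback_fibre f g
  constructor
  · intro h
    let e := h.isoIsPullback _ _ hfib
    have he : Function.Bijective e.hom.hom :=
      (ConcreteCategory.isIso_iff_bijective e.hom).mp inferInstance
    have hfst : ∀ w, (e.hom.hom w).1.1 = a.hom w :=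
      ConcreteCategory.congr_hom (h.isoIsPullback_hom_fst _ _ hfib)
    have hsnd : ∀ w, (e.hom.hom w).1.2 = b.hom w :=
      ConcreteCategory.congr_hom (h.isoIsPullback_hom_snd _ _ hfib)
    refine ⟨h.w, Subgroup.disjoint_def.mpr fun {w} ha hb => he.1 ?_, fun x y hxy => ?_⟩
    · rw [map_one]
      exact Subtype.ext (Prod.ext ((hfst w).trans ha) ((hsnd w).trans hb))
    · obtain ⟨w, hw⟩ := he.2 ⟨(x, y), hxy⟩
      exact ⟨w, (hfst w).symm.trans (by rw [hw]), (hsnd w).symm.trans (by rw [hw])⟩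
  · rintro ⟨w, hdisj, hex⟩
    let t := hfib.lift a b w
    have hfst : ∀ w, (t.hom w).1.1 = a.hom w := ConcreteCategory.congr_hom (hfib.lift_fst a b w)
    have hsnd : ∀ w, (t.hom w).1.2 = b.hom w := ConcreteCategory.congr_hom (hfib.lift_snd a b w)
    have : IsIso t := isIso_iff_ker_eq_bot_and_surjective.mpr
      ⟨(Subgroup.eq_bot_iff_forall _).mpr fun x hx => Subgroup.disjoint_def.mp hdisj
        ((hfst x).symm.trans (congrArg (fun z : fibre f g => z.1.1) hx))
        ((hsnd x).symm.trans (congrArg (fun z : fibre f g => z.1.2) hx)), fun z => by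
          obtain ⟨x, hx, hy⟩ := hex _ _ z.2
          exact ⟨x, Subtype.ext (Prod.ext ((hfst x).trans hx) ((hsnd x).trans hy))⟩⟩
    exact IsPullback.of_iso_pullback ⟨w⟩ (asIso t ≪≫ hfib.isoPullback)
      (by simp [t]) (by simp [t])

lemma exists_of_isPullback (h : IsPullback a b f g) {x : X} {y : Y} (hxy : f.hom x = g.hom y) :
    ∃ w, a.hom w = x ∧ b.hom w = y :=
  (isPullback_iff.mp h).2.2 x y hxy

lemma eq_of_isPullback (h : IsPullback a b f g) {w w' : W} (ha : a.hom w = a.hom w')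
    (hb : b.hom w = b.hom w') : w = w' :=
  (inv_mul_eq_one.mp <| Subgroup.disjoint_def.mp (isPullback_iff.mp h).2.1
    ((MonoidHom.eq_iff a.hom.toMonoidHom).mp ha)
    ((MonoidHom.eq_iff b.hom.toMonoidHom).mp hb)).symm

lemma surjective_fst_of_isPullback (h : IsPullback a b f g) (hg : Function.Surjective g.hom) :
    Function.Surjective a.hom := fun x =>
  have ⟨_, hy⟩ := hg (f.hom x)
  (exists_of_isPullback h hy.symm).imp fun _ hw => hw.1

end Pullback

/-- The category of extensions of `B`, the domain of the pullback functors along extensions. -/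
abbrev Extension (B : CompGrp.{u}) := (MorphismProperty.regularEpi CompGrp.{u}).Over ⊤ B

namespace Extension

variable {X B : CompGrp.{u}} {Y Z Q : Extension B}

lemma hom_surjective (Y : Extension B) : Function.Surjective Y.hom.hom :=
  (isRegularEpi_iff_surjective _).mp Y.prop

lemma hom_left_apply (f : Y ⟶ Z) (y : Y.left) : Z.hom.hom (f.left.hom y) = Y.hom.hom y :=
  ConcreteCategory.congr_hom (MorphismProperty.Over.w f) y

lemma congr_left_apply {f g : Y ⟶ Z} (h : f = g) (y : Y.left) : f.left.hom y = g.left.hom y := by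
  rw [h]

lemma isIso_of_isIso_left (f : Y ⟶ Z) [IsIso f.left] : IsIso f :=
  (MorphismProperty.Over.isoMk (asIso f.left) (MorphismProperty.Over.w f)).isIso_hom

/-- The quotient of an extension by a closed normal subgroup of its kernel. -/
def quotient (Y : Extension B) (N : Subgroup Y.left) [N.Normal] (hN : IsClosed (N : Set Y.left))
    (h : N ≤ ker Y.hom) : Extension B :=
  MorphismProperty.Over.mk ⊤ (quotLift N hN Y.hom h) <|
    (isRegularEpi_iff_surjective _).mpr <|
      surjective_of_comp (q := quotMk N hN) Y.hom_surjective

/-- The projection onto a quotient of an extension. -/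
def quotientMk (Y : Extension B) (N : Subgroup Y.left) [N.Normal]
    (hN : IsClosed (N : Set Y.left)) (h : N ≤ ker Y.hom) : Y ⟶ Y.quotient N hN h :=
  MorphismProperty.Over.homMk (quotMk N hN) rfl

/-- `q` is the quotient by the image under `f` of the kernel of `g`.  This describes the
coequalizer of a reflexive pair without reference to other objects, in a form that is visibly
stable under pullback. -/
structure IsKernelQuotient (f g : Y ⟶ Z) (q : Z ⟶ Q) : Prop where
  w : f ≫ q = g ≫ q
  surjective : Function.Surjective q.left.hom
  ker_le : ker q.left ≤ (ker g.left).map f.left.hom.toMonoidHom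

lemma IsKernelQuotient.nonempty_isColimit {f g : Y ⟶ Z} {q : Z ⟶ Q}
    (h : IsKernelQuotient f g q) : Nonempty (IsColimit (Cofork.ofπ q h.w)) := by
  have := ConcreteCategory.epi_of_surjective q.left h.surjective
  refine ⟨Cofork.IsColimit.mk' _ fun s => ?_⟩
  have hdesc : ∃ l : Q.left ⟶ s.pt.left, q.left ≫ l = s.π.left := by
    refine exists_desc h.surjective (h.ker_le.trans ?_)
    rintro _ ⟨y, hy, rfl⟩
    exact (congr_left_apply s.condition y).trans
      ((congrArg s.π.left.hom hy).trans (map_one s.π.left.hom))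
  let l := hdesc.choose
  have hl : q.left ≫ l = s.π.left := hdesc.choose_spec
  refine ⟨MorphismProperty.Over.homMk l ?_, ?_, fun {m} hm => ?_⟩
  · rw [← cancel_epi q.left, ← Category.assoc, hl]
    exact (MorphismProperty.Over.w s.π).trans (MorphismProperty.Over.w q).symm
  · ext1
    exact hl
  · ext1
    exact (cancel_epi q.left).mp ((congrArg (fun t : Z ⟶ s.pt => t.left) hm).trans hl.symm)

lemma exists_isKernelQuotient (f g : Y ⟶ Z) [IsReflexivePair f g] :
    ∃ (Q : Extension B) (q : Z ⟶ Q), IsKernelQuotient f g q := by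
  obtain ⟨s, hsf, hsg⟩ := IsReflexivePair.common_section f g
  let N : Subgroup Z.left := (ker g.left).map f.left.hom.toMonoidHom
  have hN : IsClosed (N : Set Z.left) := isClosed_map f.left (isClosed_ker g.left)
  have : N.Normal := (MonoidHom.normal_ker _).map _ fun z => ⟨s.left.hom z, congr_left_apply hsf z⟩
  have hNZ : N ≤ ker Z.hom := by
    rintro _ ⟨y, hy, rfl⟩
    exact (hom_left_apply f y).trans <| (hom_left_apply g y).symm.trans <|
      (congrArg Z.hom.hom hy).trans (map_one Z.hom.hom)
  refine ⟨Z.quotient N hN hNZ, Z.quotientMk N hN hNZ, ?_, quotMk_surjective N hN,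
    (ker_quotMk N hN).le⟩
  ext y
  exact QuotientGroup.eq.mpr
    (inv_mul_mem_map_ker_of_section (f := f.left.hom.toMonoidHom) (g := g.left.hom.toMonoidHom)
      (s := s.left.hom) (congr_left_apply hsf) (congr_left_apply hsg) y)

instance (B : CompGrp.{u}) : HasReflexiveCoequalizers (Extension B) where
  has_coeq _ _ f g _ :=
    have ⟨_, _, h⟩ := exists_isKernelQuotient f g
    have ⟨hc⟩ := h.nonempty_isColimit
    ⟨⟨_, hc⟩⟩

variable (p : X ⟶ B)

/-- Pulling back extensions along an arbitrary morphism. -/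
noncomputable abbrev baseChange : Extension B ⥤ Extension X :=
  MorphismProperty.Over.pullback (MorphismProperty.regularEpi CompGrp.{u}) ⊤ p

/-- The projection from the pullback of an extension to the extension. -/
noncomputable def baseChangeFst (Y : Extension B) : ((baseChange p).obj Y).left ⟶ Y.left :=
  pullback.fst Y.hom p

lemma isPullback_baseChange (Y : Extension B) :
    IsPullback (baseChangeFst p Y) ((baseChange p).obj Y).hom Y.hom p :=
  IsPullback.of_hasPullback Y.hom p

lemma baseChange_map_fst (f : Y ⟶ Z) : ((baseChange p).map f).left ≫ baseChangeFst p Z =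
    baseChangeFst p Y ≫ f.left :=
  pullback.lift_fst (pullback.fst Y.hom p ≫ f.left) (pullback.snd Y.hom p) _

lemma isPullback_baseChange_map (f : Y ⟶ Z) :
    IsPullback ((baseChange p).map f).left (baseChangeFst p Y) (baseChangeFst p Z) f.left := by
  refine IsPullback.of_right ?_ (baseChange_map_fst p f) (isPullback_baseChange p Z).flip
  rw [MorphismProperty.Over.w, MorphismProperty.Over.w]
  exact (isPullback_baseChange p Y).flip

variable {p}

lemma reflectsIsomorphisms_baseChange (hp : Function.Surjective p.hom) :
    (baseChange p).ReflectsIsomorphisms := by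
  refine ⟨fun {Y Z} f _ => ?_⟩
  have : IsIso ((baseChange p).map f).left :=
    inferInstanceAs (IsIso ((MorphismProperty.Over.forget _ _ _ ⋙ Over.forget X).map
      ((baseChange p).map f)))
  have hsq := isPullback_baseChange_map p f
  obtain ⟨hker, hsurj⟩ := isIso_iff_ker_eq_bot_and_surjective.mp this
  have : IsIso f.left := by
    refine isIso_iff_ker_eq_bot_and_surjective.mpr
      ⟨(Subgroup.eq_bot_iff_forall _).mpr fun y hy => ?_, fun z => ?_⟩
    · obtain ⟨t, ht, rfl⟩ := exists_of_isPullback hsq (x := 1) (y := y)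
        ((map_one (baseChangeFst p Z).hom).trans hy.symm)
      rw [(Subgroup.eq_bot_iff_forall _).mp hker t ht, map_one]
    · obtain ⟨t, rfl⟩ := surjective_fst_of_isPullback (isPullback_baseChange p Z) hp z
      obtain ⟨t, rfl⟩ := hsurj t
      exact ⟨_, (ConcreteCategory.congr_hom hsq.w t).symm⟩
  exact isIso_of_isIso_left f

lemma IsKernelQuotient.baseChange {f g : Y ⟶ Z} {q : Z ⟶ Q} (h : IsKernelQuotient f g q) :
    IsKernelQuotient ((baseChange p).map f) ((baseChange p).map g) ((baseChange p).map q) where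
  w := by rw [← Functor.map_comp, h.w, Functor.map_comp]
  surjective := surjective_fst_of_isPullback (isPullback_baseChange_map p q) h.surjective
  ker_le t ht := by
    have hfst : (baseChangeFst p Z).hom t ∈ ker q.left :=
      (ConcreteCategory.congr_hom (isPullback_baseChange_map p q).w t).symm.trans
        ((congrArg (baseChangeFst p Q).hom ht).trans (map_one (baseChangeFst p Q).hom))
    obtain ⟨y, hy, hyt⟩ := h.ker_le hfst
    obtain ⟨t', rfl, rfl⟩ := exists_of_isPullback (isPullback_baseChange_map p f) hyt.symm
    refine ⟨t', eq_of_isPullback (isPullback_baseChange p Z) ?_ ?_, rfl⟩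
    · exact (ConcreteCategory.congr_hom (baseChange_map_fst p g) t').trans
        (hy.trans (map_one (baseChangeFst p Z).hom).symm)
    · let F := CompGrp.Extension.baseChange p
      have hf := hom_left_apply (F.map f) t'
      have hg := hom_left_apply (F.map g) t'
      have hq := hom_left_apply (F.map q) ((F.map f).left.hom t')
      have hone : (F.obj Q).hom.hom ((F.map q).left.hom ((F.map f).left.hom t')) = 1 :=
        (congrArg (F.obj Q).hom.hom ht).trans (map_one (F.obj Q).hom.hom)
      exact hg.trans <| hf.symm.trans <| hq.symm.trans <| hone.trans
        (map_one (F.obj Z).hom.hom).symm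

lemma preservesColimitOfIsReflexivePair_baseChange :
    Monad.PreservesColimitOfIsReflexivePair (baseChange p) where
  out {_ _} f g _ := by
    obtain ⟨Q, q, h⟩ := exists_isKernelQuotient f g
    obtain ⟨hc⟩ := h.nonempty_isColimit
    obtain ⟨hc'⟩ := (h.baseChange (p := p)).nonempty_isColimit
    exact preservesColimit_of_preserves_colimit_cocone hc
      ((isColimitMapCoconeCoforkEquiv (baseChange p) h.w).symm hc')

end Extension

lemma isMonadicExtension_of_surjective {X B : CompGrp.{u}} {p : X ⟶ B}
    (hp : Function.Surjective p.hom) : galoisStructure.{u}.IsMonadicExtension p := by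
  have hreg : MorphismProperty.regularEpi CompGrp.{u} p := (isRegularEpi_iff_surjective p).mpr hp
  have := Extension.reflectsIsomorphisms_baseChange hp
  have := Extension.preservesColimitOfIsReflexivePair_baseChange (p := p)
  have hmonadic : MonadicRightAdjoint (Extension.baseChange p) :=
    Monad.monadicOfHasPreservesReflexiveCoequalizersOfReflectsIsomorphisms
      (MorphismProperty.Over.mapPullbackAdj _ ⊤ p hreg trivial)
  exact ⟨hreg, ⟨hmonadic⟩⟩

section Radical

variable {G H : CompGrp.{u}}

/-- The reflection `G ⟶ I(G)` of a compact group to the abelian profinite groups. -/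
def toReflection (G : CompGrp.{u}) : G ⟶ incl.obj (reflector.obj G) := reflectorAdj.unit.app G

lemma toReflection_surjective (G : CompGrp.{u}) : Function.Surjective (toReflection G).hom :=
  unit_surjective G

lemma toReflection_naturality (f : G ⟶ H) :
    f ≫ toReflection H = toReflection G ≫ incl.map (reflector.map f) :=
  reflectorAdj.unit.naturality f

/-- The radical of `G`: the smallest closed normal subgroup with an abelian profinite quotient,
defined as the kernel of `G ⟶ I(G)`. -/
def radical (G : CompGrp.{u}) : Subgroup G := ker (toReflection G)

instance : (radical G).Normal := MonoidHom.normal_ker _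

lemma isClosed_radical (G : CompGrp.{u}) : IsClosed (radical G : Set G) :=
  isClosed_ker _

lemma toReflection_mem_ker_iff (f : G ⟶ H) {x : G} :
    (toReflection G).hom x ∈ ker (incl.map (reflector.map f)) ↔ f.hom x ∈ radical H := by
  have hx := ConcreteCategory.congr_hom (toReflection_naturality f) x
  exact ⟨hx.trans, hx.symm.trans⟩

lemma radical_le_comap (f : G ⟶ H) : radical G ≤ (radical H).comap f.hom.toMonoidHom :=
  fun _ hx => (toReflection_mem_ker_iff f).mp <|
    (congrArg (incl.map (reflector.map f)).hom hx).trans (map_one (incl.map (reflector.map f)).hom)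

lemma isAbelian_incl (C : AbProf.{u}) : isAbelian (incl.obj C) := C.obj.property

instance (C : AbProf.{u}) : TotallyDisconnectedSpace (incl.obj C) := C.property

lemma radical_le_ker (hH : isAbelian H) [hd : TotallyDisconnectedSpace H] (f : G ⟶ H) :
    radical G ≤ ker f := by
  let C : AbProf.{u} := ⟨⟨H, hH⟩, hd⟩
  let g : incl.obj (reflector.obj G) ⟶ H := incl.map ((reflectorAdj.homEquiv G C).symm f)
  have hg : toReflection G ≫ g = f :=
    (reflectorAdj.homEquiv_unit G C _).symm.trans (Equiv.apply_symm_apply _ f)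
  rw [← hg]
  exact fun x hx => (congrArg g.hom hx).trans (map_one g.hom)

lemma closedDerived_le_radical (G : CompGrp.{u}) : closedDerived G ≤ radical G :=
  hom_closedDerived (isAbelian_incl _) (toReflection G)

lemma idComp_le_radical (G : CompGrp.{u}) : idComp G ≤ radical G :=
  hom_idComp (toReflection G)

lemma isAbelian_of_commutator_le_ker {q : G ⟶ H} (hq : Function.Surjective q.hom)
    (h : commutator G ≤ ker q) : isAbelian H := by
  intro x y
  obtain ⟨x, rfl⟩ := hq x
  obtain ⟨y, rfl⟩ := hq y
  rw [← commutatorElement_eq_one_iff_mul_comm, ← map_commutatorElement]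
  exact h (Subgroup.commutator_mem_commutator (Subgroup.mem_top x) (Subgroup.mem_top y))

lemma totallyDisconnectedSpace_of_idComp_le_ker {q : G ⟶ H} (hq : Function.Surjective q.hom)
    (h : idComp G ≤ ker q) : TotallyDisconnectedSpace H := by
  have hcl := isClosed_idComp G
  obtain ⟨l, rfl⟩ := exists_desc (quotMk_surjective _ hcl) ((ker_quotMk _ hcl).trans_le h)
  have := totallyDisconnected_quot_idComp G
  exact totallyDisconnectedSpace_of_surjective (surjective_of_comp hq)

lemma radical_le_ker_iff {q : G ⟶ H} (hq : Function.Surjective q.hom) :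
    radical G ≤ ker q ↔ isAbelian H ∧ TotallyDisconnectedSpace H :=
  ⟨fun h => ⟨isAbelian_of_commutator_le_ker hq <|
      (Subgroup.le_topologicalClosure _).trans ((closedDerived_le_radical G).trans h),
    totallyDisconnectedSpace_of_idComp_le_ker hq ((idComp_le_radical G).trans h)⟩,
  fun ⟨hH, _⟩ => radical_le_ker hH q⟩

lemma map_radical {f : G ⟶ H} (hf : Function.Surjective f.hom) :
    (radical G).map f.hom.toMonoidHom = radical H := by
  refine le_antisymm (Subgroup.map_le_iff_le_comap.mpr (radical_le_comap f)) ?_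
  let N : Subgroup H := (radical G).map f.hom.toMonoidHom
  have hN : IsClosed (N : Set H) := isClosed_map f (isClosed_radical G)
  have : N.Normal := Subgroup.Normal.map inferInstance _ hf
  have hG : radical G ≤ ker (f ≫ quotMk N hN) :=
    fun x hx => quotMk_eq_one N hN (Subgroup.mem_map_of_mem _ hx)
  have hs : Function.Surjective (f ≫ quotMk N hN).hom := (quotMk_surjective N hN).comp hf
  have hN' := (radical_le_ker_iff hs).mp hG
  exact ((radical_le_ker_iff (quotMk_surjective N hN)).mpr hN').trans (ker_quotMk N hN).le

lemma radical_eq (G : CompGrp.{u}) : radical G = closedDerived G ⊔ idComp G := by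
  refine le_antisymm ?_ (sup_le (closedDerived_le_radical G) (idComp_le_radical G))
  have hcl := isClosed_sup_of_normal (isClosed_closedDerived G) (isClosed_idComp G)
  have hq := quotMk_surjective _ hcl
  have hker := ker_quotMk _ hcl
  refine ((radical_le_ker_iff hq).mpr ⟨isAbelian_of_commutator_le_ker hq ?_,
    totallyDisconnectedSpace_of_idComp_le_ker hq (le_sup_right.trans hker.ge)⟩).trans hker.le
  exact (Subgroup.le_topologicalClosure _).trans (le_sup_left.trans hker.ge)

lemma isTrivialExtension_iff {f : G ⟶ H} (hf : Function.Surjective f.hom) :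
    galoisStructure.{u}.IsTrivialExtension f ↔ Disjoint (ker f) (radical G) := by
  have hpb : galoisStructure.{u}.IsTrivialExtension f ↔
      IsPullback (toReflection G) f (incl.map (reflector.map f)) (toReflection H) :=
    and_iff_right ((isRegularEpi_iff_surjective f).mpr hf)
  rw [hpb, isPullback_iff, disjoint_comm, and_iff_right (toReflection_naturality f).symm]
  refine and_iff_left fun ξ y hξy => ?_
  obtain ⟨x, rfl⟩ := toReflection_surjective G ξ
  have hxy : (toReflection H).hom (f.hom x) = (toReflection H).hom y :=
    (ConcreteCategory.congr_hom (toReflection_naturality f) x).trans hξy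
  obtain ⟨r, hr, hry⟩ := (map_radical hf).ge
    ((MonoidHom.eq_iff (toReflection H).hom.toMonoidHom).mp hxy.symm)
  refine ⟨x * r, (map_mul _ x r).trans ?_, (map_mul _ x r).trans ?_⟩
  · exact mul_eq_left.mpr hr
  · exact (congrArg (f.hom x * ·) hry).trans (mul_inv_cancel_left _ _)

end Radical

section CentralKernel

variable {X Y B : CompGrp.{u}}

/-- The kernel of a morphism, as an object. -/
def kerObj (p : X ⟶ B) : CompGrp.{u} := ofClosed (ker p) (isClosed_ker p)

/-- The condition on a surjection that characterizes the normal extensions. -/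
structure HasCentralProfiniteKernel (p : X ⟶ B) : Prop where
  ker_le_center : ker p ≤ Subgroup.center X
  isTotallyDisconnected_ker : IsTotallyDisconnected (ker p : Set X)

namespace HasCentralProfiniteKernel

variable {p : X ⟶ B}

lemma isAbelian_kerObj (hp : HasCentralProfiniteKernel p) : isAbelian (kerObj p) :=
  fun x y => Subtype.ext (Subgroup.mem_center_iff.mp (hp.ker_le_center y.2) x.1)

lemma totallyDisconnectedSpace_kerObj (hp : HasCentralProfiniteKernel p) :
    TotallyDisconnectedSpace (kerObj p) :=
  totallyDisconnectedSpace_subtype_iff.mpr hp.isTotallyDisconnected_ker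

lemma radical_le_eqLocus (hp : HasCentralProfiniteKernel p) {a b : Y ⟶ X} (h : a ≫ p = b ≫ p) :
    radical Y ≤ a.hom.toMonoidHom.eqLocus b.hom.toMonoidHom := by
  have hmem : ∀ y, (a.hom y)⁻¹ * b.hom y ∈ ker p := fun y =>
    (MonoidHom.eq_iff p.hom.toMonoidHom).mp (ConcreteCategory.congr_hom h y).symm
  let d : Y ⟶ kerObj p := ofHom (H := kerObj p)
    ⟨(invMulOfMemCenter a.hom.toMonoidHom b.hom.toMonoidHom
        fun y => hp.ker_le_center (hmem y)).codRestrict (ker p) hmem,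
      (a.hom.continuous_toFun.inv.mul b.hom.continuous_toFun).subtype_mk hmem⟩
  have := hp.totallyDisconnectedSpace_kerObj
  exact fun y hy =>
    inv_mul_eq_one.mp (congrArg Subtype.val (radical_le_ker hp.isAbelian_kerObj d hy))

end HasCentralProfiniteKernel

variable (p : X ⟶ B)

lemma fst_kernelPair_surjective : Function.Surjective (pullback.fst p p).hom :=
  fun x => ⟨(pullback.diagonal p).hom x,
    ConcreteCategory.congr_hom (pullback.diagonal_fst p) x⟩

variable {p} {S : Subgroup X}

/-- A closed subgroup of the kernel of `p` embeds into the kernel pair by `x ↦ (1, x)`. -/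
noncomputable def toKernelPair (hS : IsClosed (S : Set X)) (h : S ≤ ker p) :
    ofClosed S hS ⟶ pullback p p :=
  pullback.lift 0 (ofClosedIncl hS) <| by
    ext x
    exact (map_one p.hom).trans (h x.2).symm

lemma fst_toKernelPair (hS : IsClosed (S : Set X)) (h : S ≤ ker p) (x : S) :
    (pullback.fst p p).hom ((toKernelPair hS h).hom x) = 1 :=
  ConcreteCategory.congr_hom (pullback.lift_fst (f := p) (g := p) 0 (ofClosedIncl hS) _) x

lemma snd_toKernelPair (hS : IsClosed (S : Set X)) (h : S ≤ ker p) (x : S) :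
    (pullback.snd p p).hom ((toKernelPair hS h).hom x) = x :=
  ConcreteCategory.congr_hom (pullback.lift_snd (f := p) (g := p) 0 (ofClosedIncl hS) _) x

lemma toKernelPair_injective (hS : IsClosed (S : Set X)) (h : S ≤ ker p) :
    Function.Injective (toKernelPair hS h).hom := fun x y hxy =>
  Subtype.ext <| (snd_toKernelPair hS h x).symm.trans <|
    (congrArg (pullback.snd p p).hom hxy).trans (snd_toKernelPair hS h y)

open scoped commutatorElement in
lemma hasCentralProfiniteKernel_of_disjoint
    (h : Disjoint (ker (pullback.fst p p)) (radical (pullback p p))) :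
    HasCentralProfiniteKernel p := by
  rw [Subgroup.disjoint_def] at h
  let i : kerObj p ⟶ pullback p p := toKernelPair (isClosed_ker p) le_rfl
  have hi (k : ker p) : i.hom k ∈ ker (pullback.fst p p) :=
    fst_toKernelPair (isClosed_ker p) le_rfl k
  refine ⟨fun x hx => Subgroup.mem_center_iff.mpr fun y => ?_, ?_⟩
  · let k : kerObj p := ⟨x, hx⟩
    let c : (pullback p p : CompGrp.{u}) := ⁅(pullback.diagonal p).hom y, i.hom k⁆
    have hfst : c ∈ ker (pullback.fst p p) :=
      (map_commutatorElement (pullback.fst p p).hom _ _).trans <|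
        (congrArg (⁅_, ·⁆) (hi k)).trans (commutatorElement_one_right _)
    have hrad : c ∈ radical (pullback p p) :=
      closedDerived_le_radical _ <| Subgroup.le_topologicalClosure _ <|
        Subgroup.commutator_mem_commutator (Subgroup.mem_top _) (Subgroup.mem_top _)
    have hsnd : (pullback.snd p p).hom c = ⁅y, x⁆ :=
      (map_commutatorElement (pullback.snd p p).hom _ _).trans <| congrArg₂ (⁅·, ·⁆)
        (ConcreteCategory.congr_hom (pullback.diagonal_snd p) y) (snd_toKernelPair _ le_rfl k)
    exact commutatorElement_eq_one_iff_mul_comm.mp <| hsnd.symm.trans <|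
      (congrArg (pullback.snd p p).hom (h hfst hrad)).trans (map_one (pullback.snd p p).hom)
  · have hrad : radical (kerObj p) ≤ ker (𝟙 (kerObj p)) := fun k hk =>
      toKernelPair_injective (isClosed_ker p) le_rfl <|
        (h (hi k) (radical_le_comap i hk)).trans (map_one i.hom).symm
    exact totallyDisconnectedSpace_subtype_iff.mp
      ((radical_le_ker_iff Function.surjective_id).mp hrad).2

lemma HasCentralProfiniteKernel.disjoint (hp : HasCentralProfiniteKernel p) :
    Disjoint (ker (pullback.fst p p)) (radical (pullback p p)) :=
  Subgroup.disjoint_def.mpr fun {r} hr₁ hr₂ => by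
    have hr : (pullback.fst p p).hom r = (pullback.snd p p).hom r :=
      hp.radical_le_eqLocus pullback.condition hr₂
    exact eq_of_isPullback (IsPullback.of_hasPullback p p)
      (hr₁.trans (map_one (pullback.fst p p).hom).symm)
      (hr.symm.trans (hr₁.trans (map_one (pullback.snd p p).hom).symm))

lemma isNormalExtension_iff : galoisStructure.{u}.IsNormalExtension p ↔
    Function.Surjective p.hom ∧ HasCentralProfiniteKernel p := by
  rw [GaloisStructure.IsNormalExtension, isTrivialExtension_iff (fst_kernelPair_surjective p)]
  exact and_congr
    ⟨fun h => (isRegularEpi_iff_surjective p).mp h.1, isMonadicExtension_of_surjective⟩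
    ⟨hasCentralProfiniteKernel_of_disjoint, fun hp => hp.disjoint⟩

end CentralKernel

section GaloisGroup

variable {X Y B : CompGrp.{u}}

/-- The intersection of the kernel of `p` with the radical of its domain.  For a normal extension
`p` this is the Galois group. -/
def kerRadical (p : X ⟶ B) : Subgroup X := ker p ⊓ radical X

lemma isClosed_kerRadical (p : X ⟶ B) : IsClosed (kerRadical p : Set X) :=
  (isClosed_ker p).inter (isClosed_radical X)

lemma kerRadical_le_ker (p : X ⟶ B) : kerRadical p ≤ ker p := inf_le_left

/-- `kerRadical p`, as an object. -/
def kerRadicalObj (p : X ⟶ B) : CompGrp.{u} := ofClosed (kerRadical p) (isClosed_kerRadical p)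

lemma kerRadical_le_comap {p : X ⟶ B} {q : Y ⟶ B} {u : X ⟶ Y} (hu : u ≫ q = p) :
    kerRadical p ≤ (kerRadical q).comap u.hom.toMonoidHom := by
  rw [kerRadical, kerRadical, Subgroup.comap_inf, ← ker_comp, hu]
  exact inf_le_inf_left _ (radical_le_comap u)

lemma map_kerRadical {q : X ⟶ Y} (hq : Function.Surjective q.hom) (p : Y ⟶ B) :
    (kerRadical (q ≫ p)).map q.hom.toMonoidHom = kerRadical p := by
  refine le_antisymm (Subgroup.map_le_iff_le_comap.mpr (kerRadical_le_comap rfl)) ?_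
  rintro y ⟨hy, hyr⟩
  obtain ⟨x, hx, rfl⟩ := (map_radical hq).ge hyr
  exact ⟨x, ⟨hy, hx⟩, rfl⟩

/-- `kerRadical` does not distinguish two normal extensions of `B` that map to each other. -/
def kerRadicalIso {p : X ⟶ B} {q : Y ⟶ B} (hp : HasCentralProfiniteKernel p)
    (hq : HasCentralProfiniteKernel q) {u : X ⟶ Y} (hu : u ≫ q = p) {v : Y ⟶ X}
    (hv : v ≫ p = q) : kerRadicalObj p ≅ kerRadicalObj q where
  hom := ofClosedMap u (isClosed_kerRadical p) (isClosed_kerRadical q) (kerRadical_le_comap hu)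
  inv := ofClosedMap v (isClosed_kerRadical q) (isClosed_kerRadical p) (kerRadical_le_comap hv)
  hom_inv_id := by
    have h : (u ≫ v) ≫ p = 𝟙 X ≫ p := by rw [Category.assoc, hv, hu, Category.id_comp]
    exact hom_ext fun x : kerRadical p => Subtype.ext (hp.radical_le_eqLocus h x.2.2)
  inv_hom_id := by
    have h : (v ≫ u) ≫ q = 𝟙 Y ≫ q := by rw [Category.assoc, hu, hv, Category.id_comp]
    exact hom_ext fun y : kerRadical q => Subtype.ext (hq.radical_le_eqLocus h y.2.2)

lemma subsingleton_of_isZero {Z : AbProf.{u}} (hZ : IsZero Z) : Subsingleton (incl.obj Z) := by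
  have h (z : incl.obj Z) : z = 1 := ConcreteCategory.congr_hom
    (congrArg incl.map (hZ.eq_of_src (𝟙 Z) 0)) z
  exact ⟨fun z z' => (h z).trans (h z').symm⟩

open scoped ZeroObject in
lemma isPullback_prodLift_zero {N R A A' : AbProf.{u}} {i : N ⟶ R} {a : R ⟶ A} {b : R ⟶ A'}
    (hinj : Function.Injective (incl.map i).hom)
    (hrange : (incl.map i).hom.toMonoidHom.range = ker (incl.map a) ⊓ ker (incl.map b)) :
    IsPullback i 0 (prod.lift a b) (0 : 0 ⟶ A ⨯ A') := by
  have hi (n : incl.obj N) : (incl.map i).hom n ∈ ker (incl.map a) ⊓ ker (incl.map b) :=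
    hrange.le ⟨n, rfl⟩
  have w : i ≫ prod.lift a b = 0 ≫ (0 : 0 ⟶ A ⨯ A') := by
    rw [zero_comp]
    refine Limits.prod.hom_ext ?_ ?_
    · rw [Category.assoc, prod.lift_fst, zero_comp]
      exact incl.map_injective (hom_ext fun n => (hi n).1)
    · rw [Category.assoc, prod.lift_snd, zero_comp]
      exact incl.map_injective (hom_ext fun n => (hi n).2)
  have hker : ker (incl.map i) = ⊥ := (MonoidHom.ker_eq_bot_iff _).mpr hinj
  refine IsPullback.of_map incl w (isPullback_iff.mpr
    ⟨by rw [← incl.map_comp, w, incl.map_comp], hker ▸ disjoint_bot_left, fun r z hr => ?_⟩)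
  have := subsingleton_of_isZero (isZero_zero AbProf.{u})
  have ha : r ∈ ker (incl.map a) := by
    rw [← prod.lift_fst a b, incl.map_comp]
    exact (congrArg (incl.map prod.fst).hom hr).trans (map_one (incl.map prod.fst).hom)
  have hb : r ∈ ker (incl.map b) := by
    rw [← prod.lift_snd a b, incl.map_comp]
    exact (congrArg (incl.map prod.snd).hom hr).trans (map_one (incl.map prod.snd).hom)
  obtain ⟨n, hn⟩ := hrange.ge ⟨ha, hb⟩
  exact ⟨n, hn, Subsingleton.elim _ _⟩

/-- The comparison of `kerRadical p` with the reflection of the kernel pair of `p`. -/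
noncomputable def kerRadicalToReflection (p : X ⟶ B) :
    kerRadicalObj p ⟶ incl.obj (reflector.obj (pullback p p)) :=
  toKernelPair (isClosed_kerRadical p) (kerRadical_le_ker p) ≫ toReflection (pullback p p)

lemma range_kerRadicalToReflection (p : X ⟶ B) :
    (kerRadicalToReflection p).hom.toMonoidHom.range =
      ker (incl.map (reflector.map (pullback.fst p p))) ⊓
        ker (incl.map (reflector.map (pullback.snd p p))) := by
  let i : kerRadicalObj p ⟶ pullback p p :=
    toKernelPair (isClosed_kerRadical p) (kerRadical_le_ker p)
  have hfst (n : kerRadical p) : (pullback.fst p p).hom (i.hom n) = 1 := fst_toKernelPair _ _ n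
  have hsnd (n : kerRadical p) : (pullback.snd p p).hom (i.hom n) = n := snd_toKernelPair _ _ n
  refine le_antisymm ?_ ?_
  · rintro _ ⟨n, rfl⟩
    exact ⟨(toReflection_mem_ker_iff _).mpr ((hfst n).symm ▸ one_mem (radical X)),
      (toReflection_mem_ker_iff _).mpr ((hsnd n).symm ▸ n.2.2)⟩
  · rintro r ⟨h₁, h₂⟩
    obtain ⟨t, rfl⟩ := toReflection_surjective _ r
    let x := (pullback.fst p p).hom t
    let y := (pullback.snd p p).hom t
    have hx : x ∈ radical X := (toReflection_mem_ker_iff _).mp h₁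
    have hy : y ∈ radical X := (toReflection_mem_ker_iff _).mp h₂
    have hxy : p.hom y = p.hom x := (ConcreteCategory.congr_hom pullback.condition t).symm
    let n : kerRadical p := ⟨x⁻¹ * y,
      (MonoidHom.eq_iff p.hom.toMonoidHom).mp hxy,
        (radical X).mul_mem ((radical X).inv_mem hx) hy⟩
    let Δx := (pullback.diagonal p).hom x
    have hΔ : Δx * i.hom n = t := by
      refine eq_of_isPullback (IsPullback.of_hasPullback p p) ?_ ?_
      · rw [map_mul, hfst, mul_one]
        exact ConcreteCategory.congr_hom (pullback.diagonal_fst p) x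
      · rw [map_mul, hsnd]
        exact (congrArg (· * (x⁻¹ * y))
          (ConcreteCategory.congr_hom (pullback.diagonal_snd p) x)).trans
            (mul_inv_cancel_left x y)
    have hΔx : (toReflection (pullback p p)).hom Δx = 1 := radical_le_comap (pullback.diagonal p) hx
    exact ⟨n, by rw [← hΔ, map_mul, hΔx, one_mul]; rfl⟩

lemma kerRadicalToReflection_injective {p : X ⟶ B} (hp : HasCentralProfiniteKernel p) :
    Function.Injective (kerRadicalToReflection p).hom := by
  refine (injective_iff_map_eq_one _).mpr fun n hn => ?_
  have hS := isClosed_kerRadical p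
  have hle := kerRadical_le_ker p
  exact toKernelPair_injective hS hle <|
    (Subgroup.disjoint_def.mp hp.disjoint (fst_toKernelPair hS hle n) hn).trans
      (map_one (toKernelPair hS hle).hom).symm

/-- `kerRadical p`, as an abelian profinite group. -/
def HasCentralProfiniteKernel.kerRadicalProf {p : X ⟶ B} (hp : HasCentralProfiniteKernel p) :
    AbProf.{u} :=
  ⟨⟨kerRadicalObj p, fun x y =>
      Subtype.ext (Subgroup.mem_center_iff.mp (hp.ker_le_center y.2.1) x.1)⟩,
    totallyDisconnectedSpace_subtype_iff.mpr fun t ht =>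
      hp.isTotallyDisconnected_ker t (ht.trans (kerRadical_le_ker p))⟩

/-- The Galois group of a normal extension `p` is `kerRadical p`. -/
noncomputable def galoisGroupIso {p : X ⟶ B} (hp : HasCentralProfiniteKernel p) :
    incl.obj (galoisStructure.{u}.galoisGroup p) ≅ kerRadicalObj p :=
  have hi : incl.map (incl.preimage (X := hp.kerRadicalProf) (kerRadicalToReflection p)) =
      kerRadicalToReflection p := incl.map_preimage _
  have hpb := isPullback_prodLift_zero (N := hp.kerRadicalProf)
    (i := incl.preimage (kerRadicalToReflection p))
    (a := reflector.map (pullback.fst p p)) (b := reflector.map (pullback.snd p p))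
    (by rw [hi]; exact kerRadicalToReflection_injective hp)
    (by rw [hi]; exact range_kerRadicalToReflection p)
  (incl.mapIso hpb.isoPullback).symm

end GaloisGroup

section HopfFormula

open scoped commutatorElement

variable {P X B : CompGrp.{u}} {K : Subgroup P}

lemma isClosed_hopfDen [K.Normal] (hK : IsClosed (K : Set P)) : IsClosed (hopfDen K : Set P) :=
  isClosed_sup_of_normal (Subgroup.isClosed_topologicalClosure _)
    (isClosed_map (ofClosedIncl hK) (isClosed_idComp (ofClosed K hK)))

lemma hopfDen_le [K.Normal] (hK : IsClosed (K : Set P)) : hopfDen K ≤ K :=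
  sup_le (Subgroup.topologicalClosure_minimal _ (Subgroup.commutator_le_left _ _) hK)
    (Subgroup.map_subtype_le _)

lemma hopfDen_le_ker {l : P ⟶ X} (hc : K.map l.hom.toMonoidHom ≤ Subgroup.center X)
    (hd : IsTotallyDisconnected (K.map l.hom.toMonoidHom : Set X)) : hopfDen K ≤ ker l := by
  refine sup_le (Subgroup.topologicalClosure_minimal _ ?_ (isClosed_ker l)) ?_
  · refine Subgroup.commutator_le.mpr fun k hk x _ => ?_
    exact (map_commutatorElement l.hom k x).trans <| commutatorElement_eq_one_iff_mul_comm.mpr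
      (Subgroup.mem_center_iff.mp (hc (Subgroup.mem_map_of_mem _ hk)) (l.hom x)).symm
  · rintro _ ⟨k, hk, rfl⟩
    have hconn : IsPreconnected ((fun k : K => l.hom k) '' connectedComponent 1) :=
      isPreconnected_connectedComponent.image _
        (l.hom.continuous_toFun.comp continuous_subtype_val).continuousOn
    have hsub : (fun k : K => l.hom k) '' connectedComponent 1 ⊆ K.map l.hom.toMonoidHom :=
      Set.image_subset_iff.mpr fun k _ => ⟨k, k.2, rfl⟩
    exact (hd _ hsub hconn ⟨k, hk, rfl⟩ ⟨1, mem_connectedComponent, rfl⟩).trans (map_one l.hom)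

lemma hopfDen_le_ker_iff (hK : IsClosed (K : Set P)) {l : P ⟶ X}
    (hl : Function.Surjective l.hom) :
    hopfDen K ≤ ker l ↔ K.map l.hom.toMonoidHom ≤ Subgroup.center X ∧
      IsTotallyDisconnected (K.map l.hom.toMonoidHom : Set X) := by
  refine ⟨fun h => ⟨?_, ?_⟩, fun h => hopfDen_le_ker h.1 h.2⟩
  · rintro _ ⟨k, hk, rfl⟩
    refine Subgroup.mem_center_iff.mpr fun y => ?_
    obtain ⟨x, rfl⟩ := hl y
    have hkx : l.hom ⁅k, x⁆ = 1 := h <| Subgroup.mem_sup_left <| Subgroup.le_topologicalClosure _ <|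
      Subgroup.commutator_mem_commutator hk (Subgroup.mem_top x)
    exact (commutatorElement_eq_one_iff_mul_comm.mp
      ((map_commutatorElement l.hom k x).symm.trans hkx)).symm
  · let r := ofClosedMap l hK (isClosed_map l hK) (Subgroup.le_comap_map _ _)
    have hr : Function.Surjective r.hom := by
      rintro ⟨_, k, hk, rfl⟩
      exact ⟨⟨k, hk⟩, rfl⟩
    have hker : idComp (ofClosed K hK) ≤ ker r := fun k hk =>
      Subtype.ext (h (Subgroup.mem_sup_right ⟨k, hk, rfl⟩))
    exact totallyDisconnectedSpace_subtype_iff.mp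
      (totallyDisconnectedSpace_of_idComp_le_ker hr hker)

/-- The extension of `B` induced by `f` on the quotient of its domain by `hopfDen (ker f)`.  It is
weakly universal when `f` lifts through all normal extensions of `B`. -/
def hopfExtension (f : P ⟶ B) : quot (hopfDen (ker f)) (isClosed_hopfDen (isClosed_ker f)) ⟶ B :=
  quotLift _ _ f (hopfDen_le (isClosed_ker f))

/-- The quotient morphism, through which `f` factors as `hopfExtensionMk f ≫ hopfExtension f`. -/
def hopfExtensionMk (f : P ⟶ B) :
    P ⟶ quot (hopfDen (ker f)) (isClosed_hopfDen (isClosed_ker f)) := quotMk _ _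

variable (f : P ⟶ B)

lemma hopfExtensionMk_surjective : Function.Surjective (hopfExtensionMk f).hom :=
  quotMk_surjective _ _

lemma ker_hopfExtensionMk : ker (hopfExtensionMk f) = hopfDen (ker f) := ker_quotMk _ _

lemma hopfExtensionMk_comp : hopfExtensionMk f ≫ hopfExtension f = f := rfl

lemma hasCentralProfiniteKernel_hopfExtension :
    HasCentralProfiniteKernel (hopfExtension f) := by
  have h := (hopfDen_le_ker_iff (isClosed_ker f) (hopfExtensionMk_surjective f)).mp
    (ker_hopfExtensionMk f).ge
  have hmap : (ker f).map (hopfExtensionMk f).hom.toMonoidHom = ker (hopfExtension f) :=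
    map_ker_comp (hopfExtensionMk_surjective f) (hopfExtension f)
  rw [hmap] at h
  exact ⟨h.1, h.2⟩

variable {f}

lemma isWeaklyUniversal_hopfExtension (hf : Function.Surjective f.hom)
    (hlift : ∀ ⦃X : CompGrp.{u}⦄ (p : X ⟶ B),
      galoisStructure.{u}.IsNormalExtension p → ∃ l, l ≫ p = f) :
    galoisStructure.{u}.IsWeaklyUniversalNormalExtension (hopfExtension f) := by
  refine ⟨isNormalExtension_iff.mpr
    ⟨surjective_of_comp (q := hopfExtensionMk f) hf, hasCentralProfiniteKernel_hopfExtension f⟩,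
    fun X p hp => ?_⟩
  obtain ⟨-, hp'⟩ := isNormalExtension_iff.mp hp
  obtain ⟨l, rfl⟩ := hlift p hp
  have hmap : (ker (l ≫ p)).map l.hom.toMonoidHom ≤ ker p := by
    rw [ker_comp]
    exact Subgroup.map_comap_le _ _
  have hker : ker (hopfExtensionMk (l ≫ p)) ≤ ker l := (ker_hopfExtensionMk (l ≫ p)).trans_le <|
    hopfDen_le_ker (hmap.trans hp'.ker_le_center)
      fun t ht => hp'.isTotallyDisconnected_ker t (ht.trans hmap)
  have hq := hopfExtensionMk_surjective (l ≫ p)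
  obtain ⟨u, hu⟩ := exists_desc hq hker
  have := ConcreteCategory.epi_of_surjective _ hq
  refine ⟨u, ?_⟩
  rw [← cancel_epi (hopfExtensionMk (l ≫ p)), reassoc_of% hu, hopfExtensionMk_comp]

variable (f)

lemma hopfNum_ker : hopfNum (ker f) = kerRadical f := by
  rw [kerRadical, radical_eq]
  rfl

/-- The subgroup `hopfNum (ker f)`, as an object. -/
def hopfNumObj : CompGrp.{u} :=
  ofClosed (hopfNum (ker f)) ((hopfNum_ker f).symm ▸ isClosed_kerRadical f)

/-- The subgroup `hopfDen (ker f)` of the object `hopfNumObj f`. -/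
def hopfDenOf : Subgroup (hopfNumObj f) := (hopfDen (ker f)).subgroupOf (hopfNum (ker f))

instance : (hopfDenOf f).Normal :=
  inferInstanceAs ((hopfDen (ker f)).subgroupOf (hopfNum (ker f))).Normal

lemma isClosed_hopfDenOf : IsClosed (hopfDenOf f : Set (hopfNumObj f)) :=
  (isClosed_hopfDen (isClosed_ker f)).preimage continuous_subtype_val

/-- The right-hand side of the Hopf formula is `kerRadical (hopfExtension f)`. -/
noncomputable def hopfQuotientIso :
    quot (hopfDenOf f) (isClosed_hopfDenOf f) ≅ kerRadicalObj (hopfExtension f) :=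
  have hmap : (hopfNum (ker f)).map (hopfExtensionMk f).hom.toMonoidHom =
      kerRadical (hopfExtension f) := by
    rw [hopfNum_ker]
    exact map_kerRadical (hopfExtensionMk_surjective f) (hopfExtension f)
  let m : hopfNumObj f ⟶ kerRadicalObj (hopfExtension f) := ofClosedMap (hopfExtensionMk f) _
    (isClosed_kerRadical _) (Subgroup.map_le_iff_le_comap.mp hmap.le)
  have hm : Function.Surjective m.hom := fun ⟨_, hy⟩ =>
    have ⟨x, hx, hxy⟩ := hmap.ge hy
    ⟨⟨x, hx⟩, Subtype.ext hxy⟩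
  have hker : ker m = hopfDenOf f := Subgroup.ext fun x =>
    Subtype.ext_iff.trans (SetLike.ext_iff.mp (ker_hopfExtensionMk f) x.1)
  quotIsoOfSurjective (isClosed_hopfDenOf f) m hm hker

end HopfFormula

end CompGrp

/-- For the reflection of compact Hausdorff groups onto abelian profinite groups: given a projective
presentation `f : P ⟶ B` with kernel `K`, the fundamental group of `B` (the Galois group of any
weakly universal normal extension of `B`, and such an extension exists) is isomorphic, as a
topological group, to `(K ∧ (cl[P, P] · P₀)) / (cl[K, P] · K₀)`. -/
theorem mainTheorem8 {P B : CompGrp.{u}} (f : P ⟶ B) (hf : IsRegularEpi f)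
    (hP : IsProjectiveWrt (MorphismProperty.regularEpi CompGrp.{u}) P) :
    (∃ (X : CompGrp.{u}) (p : X ⟶ B),
      CompGrp.galoisStructure.{u}.IsWeaklyUniversalNormalExtension p) ∧
    ∀ (X : CompGrp.{u}) (p : X ⟶ B),
      CompGrp.galoisStructure.{u}.IsWeaklyUniversalNormalExtension p →
        Nonempty ((CompGrp.incl.obj (CompGrp.galoisStructure.{u}.galoisGroup p)) ≃ₜ*
          CompGrp.HopfQuotient f.hom.toMonoidHom.ker) := by
  have hs := (CompGrp.isRegularEpi_iff_surjective f).mp hf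
  have huniv := CompGrp.isWeaklyUniversal_hopfExtension hs fun _ p hp => hP p f hp.1.1
  refine ⟨⟨_, _, huniv⟩, fun X p hpu => ?_⟩
  have hp := (CompGrp.isNormalExtension_iff.mp hpu.1).2
  have hq := CompGrp.hasCentralProfiniteKernel_hopfExtension f
  obtain ⟨u, hu⟩ := hpu.2 _ huniv.1
  obtain ⟨v, hv⟩ := huniv.2 _ hpu.1
  exact ⟨CompGrp.continuousMulEquivOfIso (CompGrp.galoisGroupIso hp ≪≫
    CompGrp.kerRadicalIso hp hq hu hv ≪≫ (CompGrp.hopfQuotientIso f).symm)⟩
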